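/- Let $U$ and $V$ be separable real Banach spaces, $X$ a separable real Hilbert space, $i\in\mathcal L(X,U)$, $C\in\mathcal L(U,V)$, $T>0$ and $0<H<\tfrac12$. Put $R(s,t)=\tfrac12\left(s^{2H}+t^{2H}-|s-t|^{2H}\right)$. Let $\mathcal E$ be the space of simple functions $\sum_{j=0}^{n-1}x_j\mathbf 1_{[t_j,t_{j+1})}$ on $[0,T]$, with $x_j\in X$ and $0=t_0<\dots<t_n=T$, equipped with the inner product determined by $$\Big\langle \sum_i x_i\mathbf 1_{[0,s_i)},\ \sum_j y_j\mathbf 1_{[0,t_j)}\Big\rangle_{\mathcal M}=\sum_{i,j}[x_i,y_j]_X\,R(s_i,t_j),$$ and let $\mathcal M$ be the closure (completion) of $\mathcal E$ with respect to this inner product, viewed as a space of functions in $L^2([0,T];X)$: a function $f\in L^2([0,T];X)$ is in $\mathcal M$ if and only if it is the limit in $L^2([0,T];X)$ of a sequence in $\mathcal E$ that is Cauchy for $\|\cdot\|_{\mathcal M}$. Let $$\mathcal I=\{\Phi:[0,T]\to\mathcal L(U,V):\ i^*\Phi^*(\cdot)v^*\in\mathcal M\ \text{ for all } v^*\in V^*\},$$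 where $i^*:U^*\to X$ after identification of $X^*$ with $X$. Let $(S(t),t\ge 0)$ be a strongly continuous semigroup on $V$ which is analytic, i.e. on the complexification $V_{\mathbb C}$ of $V$ it extends to an analytic family $(E(z))$ of bounded complex linear operators on a sector $\{z\ne 0:\ |\arg z|<\delta\}$, for some $0<\delta\le\pi/2$, with $E(z+w)=E(z)E(w)$ for all $z,w$ in the sector and $E(z)x\to x$ as $z\to0$ in the sector for all $x\in V_{\mathbb C}$; and which is of negative type, i.e. there are $M\ge 0$ and $\beta>0$ with $\|S(t)\|\le Me^{-\beta t}$ for all $t\ge 0$. Then the mapping $S(\cdot)C$ is in $\mathcal I$; that is, $i^*C^*S^*(\cdot)v^*\in\mathcal M$ for all $v^*\in V^*$. -/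

import Mathlib

open MeasureTheory Filter Topology
open scoped InnerProductSpace

/-! ### The space `𝓜` of Wiener integrands for a fractional Brownian motion -/

/-- The covariance function `R(s,t) = (s^{2H} + t^{2H} - |s-t|^{2H}) / 2` of fractional Brownian
motion with Hurst parameter `H`. -/
noncomputable def fbmCov (H s t : ℝ) : ℝ :=
  (s ^ (2 * H) + t ^ (2 * H) - |s - t| ^ (2 * H)) / 2

/-- The vector space `𝓔` of simple `X`-valued functions on `[0,T]`. The finitely supported family
`(x_s)`, `s ∈ (0,T]`, stands for the simple function `∑ x_s 1_{[0,s)}`. As the indicators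
`1_{[0,s)}`, `s ∈ (0,T]`, form a basis of the real step functions
`∑ c_i 1_{[t_i,t_{i+1})}`, `0 = t_0 < ⋯ < t_n = T`, every simple function
`∑ x_i 1_{[t_i,t_{i+1})}` has exactly one such family. -/
abbrev SimpleIntegrand (T : ℝ) (X : Type*) [Zero X] : Type _ := Set.Ioc (0 : ℝ) T →₀ X

namespace SimpleIntegrand

variable {T : ℝ} {X : Type*} [NormedAddCommGroup X] [InnerProductSpace ℝ X]

/-- The function `t ↦ ∑ x_s 1_{[0,s)}(t)`. -/
noncomputable def stepFun (g : SimpleIntegrand T X) (t : ℝ) : X :=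
  g.sum fun s x => (Set.Ico (0 : ℝ) s).indicator (fun _ => x) t

/-- `⟨∑ x_s 1_{[0,s)}, ∑ y_t 1_{[0,t)}⟩_𝓜 = ∑ ∑ [x_s, y_t] R(s,t)`. -/
noncomputable def innerM (H : ℝ) (f g : SimpleIntegrand T X) : ℝ :=
  f.sum fun s x => g.sum fun t y => ⟪x, y⟫_ℝ * fbmCov H s t

/-- `‖g‖_𝓜 = ⟨g, g⟩_𝓜 ^ (1/2)`. -/
noncomputable def normM (H : ℝ) (g : SimpleIntegrand T X) : ℝ := √(innerM H g g)

end SimpleIntegrand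

/-- `f : [0,T] → X` (values off `[0,T]` are ignored) belongs to the closure `𝓜` of the space of
simple functions with respect to `⟨·,·⟩_𝓜`, in the case `0 < H < 1/2`, where `𝓜` is continuously
embedded in `L²([0,T];X)` and so is a space of (classes of) functions: `f` is in `L²([0,T];X)`, and
it is the limit in `L²([0,T];X)` of a sequence of simple functions that is Cauchy for `‖·‖_𝓜`. -/
def MemM (H T : ℝ) {X : Type*} [NormedAddCommGroup X] [InnerProductSpace ℝ X] (f : ℝ → X) : Prop :=
  MemLp f 2 (volume.restrict (Set.Icc 0 T)) ∧
  ∃ g : ℕ → SimpleIntegrand T X,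
    (∀ ε > 0, ∃ N, ∀ m ≥ N, ∀ n ≥ N, (g m - g n).normM H < ε) ∧
    Tendsto (fun n => eLpNorm (fun t => f t - (g n).stepFun t) 2 (volume.restrict (Set.Icc 0 T)))
      atTop (𝓝 0)

/-! ### The class `𝓘` of operator valued integrands -/

/-- The adjoint `i* : U* → X` of `i : X → U`, the dual of the Hilbert space `X` being identified
with `X`: `[i* u*, x] = ⟨i x, u*⟩`. -/
noncomputable def hilbertAdjoint {X U : Type*}
    [NormedAddCommGroup X] [InnerProductSpace ℝ X] [CompleteSpace X]
    [NormedAddCommGroup U] [NormedSpace ℝ U] (i : X →L[ℝ] U) (u : StrongDual ℝ U) : X :=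
  (InnerProductSpace.toDual ℝ X).symm (u ∘L i)

/-- The class `𝓘` of the functions `Φ : [0,T] → L(U,V)` with `i* Φ*(·) v* ∈ 𝓜` for all `v* ∈ V*`,
in the case `0 < H < 1/2`. Here `Φ*(t) v* = v* ∘ Φ(t)`. -/
def MemIntegrandClass (H T : ℝ) {X U V : Type*}
    [NormedAddCommGroup X] [InnerProductSpace ℝ X] [CompleteSpace X]
    [NormedAddCommGroup U] [NormedSpace ℝ U] [NormedAddCommGroup V] [NormedSpace ℝ V]
    (i : X →L[ℝ] U) (Φ : ℝ → U →L[ℝ] V) : Prop :=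
  ∀ v : StrongDual ℝ V, MemM H T fun t => hilbertAdjoint i (v ∘L Φ t)

/-! ### The complexification of a real Banach space -/

/-- The complexification of a real normed space `V`, realised as the space of real linear maps
`ℂ → V`, with the operator norm: the vector `w = x + i y` is the map `c ↦ Re (c w)`, that is
`a + i b ↦ a x - b y`. The norm is `sup_θ ‖cos θ x - sin θ y‖`. -/
def Complexification (V : Type*) [NormedAddCommGroup V] [NormedSpace ℝ V] : Type _ := ℂ →L[ℝ] V

namespace Complexification

variable {V : Type*} [NormedAddCommGroup V] [NormedSpace ℝ V]

noncomputable instance : NormedAddCommGroup (Complexification V) :=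
  inferInstanceAs (NormedAddCommGroup (ℂ →L[ℝ] V))

instance [CompleteSpace V] : CompleteSpace (Complexification V) :=
  inferInstanceAs (CompleteSpace (ℂ →L[ℝ] V))

/-- A real linear map `ℂ → V` as an element of the complexification. -/
def mk (φ : ℂ →L[ℝ] V) : Complexification V := φ

/-- An element of the complexification as a real linear map `ℂ → V`. -/
def toCLM (w : Complexification V) : ℂ →L[ℝ] V := w

/-- Complex scalars act by `(c • w)(z) = w (c z)`. -/
noncomputable instance : SMul ℂ (Complexification V) :=
  ⟨fun c w => mk (w.toCLM ∘L ContinuousLinearMap.mul ℝ ℂ c)⟩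

theorem ext' {w w' : Complexification V} (h : ∀ z, w.toCLM z = w'.toCLM z) : w = w' :=
  ContinuousLinearMap.ext h

@[simp] theorem toCLM_smul (c : ℂ) (w : Complexification V) (z : ℂ) :
    (c • w).toCLM z = w.toCLM (c * z) := rfl

@[simp] theorem toCLM_add (w w' : Complexification V) (z : ℂ) :
    (w + w').toCLM z = w.toCLM z + w'.toCLM z := rfl

@[simp] theorem toCLM_zero (z : ℂ) : (0 : Complexification V).toCLM z = 0 := rfl

noncomputable instance : Module ℂ (Complexification V) where
  one_smul w := ext' fun z => by simp
  mul_smul c d w := ext' fun z => by simp [mul_left_comm, mul_assoc]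
  smul_zero c := ext' fun z => by simp
  smul_add c w w' := ext' fun z => by simp
  add_smul c d w := ext' fun z => by simp [add_mul]
  zero_smul w := ext' fun z => by simp

theorem norm_eq (w : Complexification V) : ‖w‖ = ‖w.toCLM‖ := rfl

noncomputable instance : NormedSpace ℂ (Complexification V) where
  norm_smul_le c w := by
    rw [norm_eq, norm_eq]
    refine ContinuousLinearMap.opNorm_le_bound _ (by positivity) fun z => ?_
    rw [toCLM_smul]
    calc ‖w.toCLM (c * z)‖ ≤ ‖w.toCLM‖ * ‖c * z‖ := w.toCLM.le_opNorm _
      _ = ‖c‖ * ‖w.toCLM‖ * ‖z‖ := by rw [norm_mul]; ring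

/-- The embedding `x ↦ x + i 0` of `V`. -/
noncomputable def ofReal (x : V) : Complexification V := mk (Complex.reCLM.smulRight x)

/-- Every vector of the complexification is uniquely of the form `x + i y`. -/
theorem existsUnique_re_im (w : Complexification V) :
    ∃! p : V × V, w = ofReal p.1 + Complex.I • ofReal p.2 := by
  have key : ∀ (p : V × V) (z : ℂ), (ofReal p.1 + Complex.I • ofReal p.2).toCLM z
      = z.re • p.1 - z.im • p.2 := by
    intro p z
    change z.re • p.1 + (Complex.I * z).re • p.2 = _
    simp [sub_eq_add_neg]
  refine ⟨(w.toCLM 1, -w.toCLM Complex.I), ext' fun z => ?_, ?_⟩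
  · rw [key]
    have hz : z = z.re • (1 : ℂ) + z.im • Complex.I := by
      apply Complex.ext <;> simp
    conv_lhs => rw [hz]
    rw [map_add, map_smul, map_smul]
    simp
  · rintro ⟨x, y⟩ rfl
    rw [key, key]
    simp

end Complexification

/-- The complex linear extension `A(x + i y) = A x + i A y` of a bounded operator `A` on `V`. -/
noncomputable def ContinuousLinearMap.complexify {V : Type*} [NormedAddCommGroup V]
    [NormedSpace ℝ V] (A : V →L[ℝ] V) : Complexification V →L[ℂ] Complexification V :=
  LinearMap.mkContinuous
    { toFun := fun w => Complexification.mk (A ∘L w.toCLM)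
      map_add' := fun _ _ => Complexification.ext' fun _ => A.map_add _ _
      map_smul' := fun _ _ => rfl }
    ‖A‖ fun w => A.opNorm_comp_le w.toCLM

/-! ### Analytic semigroups of negative type -/

section Semigroup

variable {V : Type*} [NormedAddCommGroup V] [NormedSpace ℝ V]

/-- `(S(t), t ≥ 0)` is a strongly continuous semigroup of bounded operators (values of `S` at
negative times are ignored). -/
structure IsStronglyContinuousSemigroup (S : ℝ → V →L[ℝ] V) : Prop where
  map_zero : S 0 = ContinuousLinearMap.id ℝ V
  map_add : ∀ s t, 0 ≤ s → 0 ≤ t → S (s + t) = S s ∘L S t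
  tendsto_zero : ∀ x, Tendsto (fun t => S t x) (𝓝[>] 0) (𝓝 x)

/-- The open sector of half-angle `δ` around the positive real axis. -/
def complexSector (δ : ℝ) : Set ℂ := {z | z ≠ 0 ∧ |z.arg| < δ}

/-- The strongly continuous semigroup `S` on the real Banach space `V` is analytic: on the
complexification of `V` it extends to an analytic operator family on a sector that satisfies the
semigroup law and converges strongly to the identity at `0`. -/
def IsAnalyticSemigroup (S : ℝ → V →L[ℝ] V) : Prop :=
  IsStronglyContinuousSemigroup S ∧
  ∃ δ : ℝ, 0 < δ ∧ δ ≤ Real.pi / 2 ∧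
    ∃ E : ℂ → Complexification V →L[ℂ] Complexification V,
      (∀ t : ℝ, 0 < t → E (t : ℂ) = (S t).complexify) ∧
      DifferentiableOn ℂ E (complexSector δ) ∧
      (∀ z ∈ complexSector δ, ∀ w ∈ complexSector δ, E (z + w) = E z ∘L E w) ∧
      (∀ x, Tendsto (fun z => E z x) (𝓝[complexSector δ] 0) (𝓝 x))

/-- `S` is of negative type: its growth bound, the infimum of the `ω` with
`‖S(t)‖ ≤ M e^{ω t}` for some `M` and all `t ≥ 0`, is negative. -/
def HasNegativeType (S : ℝ → V →L[ℝ] V) : Prop :=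
  ∃ M ω : ℝ, ω < 0 ∧ ∀ t, 0 ≤ t → ‖S t‖ ≤ M * Real.exp (ω * t)

end Semigroup

/-! For `H < 1/2` the increments of fractional Brownian motion over disjoint intervals are
negatively correlated, while each increment is nonnegatively correlated with the increment over any
larger interval. The Gram matrix of the cells of a partition is therefore diagonally dominant, and
twice its diagonal bounds it: `‖∑ a_j 1_{[t_j,t_{j+1})}‖_𝓜² ≤ 2 ∑ (t_{j+1} - t_j)^{2H} ‖a_j‖²`
(`formM_ofPartition_le`).

Analyticity enters through Cauchy's estimate `‖E'(s)‖ ≤ K / s` on `(0,T]`, which gives `f = i* C*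
S*(·) v*` increments of size at most a constant times `(t - s) / s`. For the dyadic step functions
of such an `f`, consecutive levels differ on the `j`-th fine cell by at most a multiple of `1 / (j +
1)`. This is square summable, so the singularity at `0` costs only a constant, and the `𝓜`-distance
of consecutive levels is `O(2^{-nH})`. The sequence is thus `𝓜`-Cauchy for every `H > 0` below
`1/2`. Since `f` is bounded and continuous on `(0,T]`, the sequence also converges to `f` in `L²`
(`memM_of_norm_sub_le_div`). -/

/-! ### Increments of fractional Brownian motion -/

/-- The covariance of the increments of fractional Brownian motion over `[a,b]` and `[c,d]`. -/
noncomputable def fbmIncCov (H a b c d : ℝ) : ℝ :=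
  fbmCov H b d - fbmCov H b c - fbmCov H a d + fbmCov H a c

theorem fbmIncCov_eq (H a b c d : ℝ) : fbmIncCov H a b c d =
    (|b - c| ^ (2 * H) + |a - d| ^ (2 * H) - |b - d| ^ (2 * H) - |a - c| ^ (2 * H)) / 2 := by
  simp only [fbmIncCov, fbmCov]; ring

theorem fbmIncCov_comm (H a b c d : ℝ) : fbmIncCov H a b c d = fbmIncCov H c d a b := by
  simp only [fbmIncCov_eq, abs_sub_comm b, abs_sub_comm a]; ring

theorem fbmIncCov_self {H a b : ℝ} (hH : 0 < H) (hab : a ≤ b) :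
    fbmIncCov H a b a b = (b - a) ^ (2 * H) := by
  have h0 : (0 : ℝ) ^ (2 * H) = 0 := Real.zero_rpow (by positivity)
  rw [fbmIncCov_eq, abs_sub_comm a b, abs_of_nonneg (sub_nonneg.2 hab)]
  simp [h0]

/-- Both `p + u` and `p + v` are convex combinations of `p` and `p + u + v`, with the weights
exchanged; adding the two concavity inequalities makes the weights sum to one. -/
theorem rpow_add_rpow_le_of_concave {α p u v : ℝ} (hα0 : 0 ≤ α) (hα1 : α ≤ 1) (hp : 0 ≤ p)
    (hu : 0 ≤ u) (hv : 0 ≤ v) :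
    p ^ α + (p + u + v) ^ α ≤ (p + u) ^ α + (p + v) ^ α := by
  rcases (add_nonneg hu hv).eq_or_lt with h | h
  · have hu0 : u = 0 := by linarith
    have hv0 : v = 0 := by linarith
    simp [hu0, hv0]
  · have hc := Real.concaveOn_rpow hα0 hα1
    have hq : p + u + v ∈ Set.Ici (0 : ℝ) := by simp only [Set.mem_Ici]; positivity
    have hsum : u / (u + v) + v / (u + v) = 1 := by field_simp
    have h1 := hc.2 hp hq (show 0 ≤ v / (u + v) by positivity)
      (show 0 ≤ u / (u + v) by positivity) (by rw [add_comm, hsum])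
    have h2 := hc.2 hp hq (show 0 ≤ u / (u + v) by positivity)
      (show 0 ≤ v / (u + v) by positivity) hsum
    have e1 : (v / (u + v)) • p + (u / (u + v)) • (p + u + v) = p + u := by
      simp only [smul_eq_mul]; field_simp; ring
    have e2 : (u / (u + v)) • p + (v / (u + v)) • (p + u + v) = p + v := by
      simp only [smul_eq_mul]; field_simp; ring
    rw [e1] at h1
    rw [e2] at h2
    simp only [smul_eq_mul] at h1 h2
    calc p ^ α + (p + u + v) ^ α
        = (u / (u + v) + v / (u + v)) * p ^ α
          + (u / (u + v) + v / (u + v)) * (p + u + v) ^ α := by rw [hsum]; ring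
      _ ≤ _ := by linarith

/-- For `H < 1/2` the increments over disjoint intervals are negatively correlated. -/
theorem fbmIncCov_nonpos {H a b c d : ℝ} (hH0 : 0 < H) (hH : H < 1 / 2)
    (hab : a ≤ b) (hbc : b ≤ c) (hcd : c ≤ d) : fbmIncCov H a b c d ≤ 0 := by
  -- Here `p` is the gap between the intervals, and `u`, `v` are their lengths.
  have h := rpow_add_rpow_le_of_concave (α := 2 * H) (p := c - b) (u := b - a) (v := d - c)
    (by linarith) (by linarith) (by linarith) (by linarith) (by linarith)
  rw [fbmIncCov_eq, abs_sub_comm b c, abs_sub_comm a d, abs_sub_comm b d, abs_sub_comm a c,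
    abs_of_nonneg (show 0 ≤ c - b by linarith), abs_of_nonneg (show 0 ≤ d - a by linarith),
    abs_of_nonneg (show 0 ≤ d - b by linarith), abs_of_nonneg (show 0 ≤ c - a by linarith)]
  rw [show c - b + (b - a) + (d - c) = d - a by ring, show c - b + (b - a) = c - a by ring,
    show c - b + (d - c) = d - b by ring] at h
  linarith

/-- Telescoping turns a row sum of the Gram matrix into a covariance with the increment over the
whole partitioned interval, whose sign `fbmIncCov_nonneg_of_subset` determines. -/
theorem sum_fbmIncCov (H a b : ℝ) (t : ℕ → ℝ) (N : ℕ) :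
    ∑ j ∈ Finset.range N, fbmIncCov H a b (t j) (t (j + 1)) = fbmIncCov H a b (t 0) (t N) := by
  induction N with
  | zero => simp [fbmIncCov]
  | succ N ih => rw [Finset.sum_range_succ, ih]; simp only [fbmIncCov]; ring

theorem fbmIncCov_nonneg_of_subset {H a b c d : ℝ} (hH0 : 0 < H)
    (hca : c ≤ a) (hab : a ≤ b) (hbd : b ≤ d) : 0 ≤ fbmIncCov H a b c d := by
  rw [fbmIncCov_eq, abs_sub_comm a d, abs_sub_comm b d,
    abs_of_nonneg (show 0 ≤ b - c by linarith), abs_of_nonneg (show 0 ≤ d - a by linarith),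
    abs_of_nonneg (show 0 ≤ d - b by linarith), abs_of_nonneg (show 0 ≤ a - c by linarith)]
  have h1 : (a - c) ^ (2 * H) ≤ (b - c) ^ (2 * H) :=
    Real.rpow_le_rpow (by linarith) (by linarith) (by positivity)
  have h2 : (d - b) ^ (2 * H) ≤ (d - a) ^ (2 * H) :=
    Real.rpow_le_rpow (by linarith) (by linarith) (by positivity)
  linarith

/-! ### Diagonally dominant Gram matrices -/

section Gram

variable {X : Type*} [NormedAddCommGroup X] [InnerProductSpace ℝ X] {ι : Type*}

/-- Polarization `2⟪a_i, a_j⟫ = ‖a_i‖² + ‖a_j‖² - ‖a_i - a_j‖²` writes the form as a row-sum part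
plus a graph-Laplacian part, so its sign can be read from the signs of the coefficients. -/
theorem sum_mul_inner_eq (s : Finset ι) (c : ι → ι → ℝ) (hc : ∀ i j, c i j = c j i) (a : ι → X) :
    ∑ i ∈ s, ∑ j ∈ s, ⟪a i, a j⟫_ℝ * c i j =
      ∑ i ∈ s, (∑ j ∈ s, c i j) * ‖a i‖ ^ 2
        - (∑ i ∈ s, ∑ j ∈ s, c i j * ‖a i - a j‖ ^ 2) / 2 := by
  have h1 : ∑ i ∈ s, ∑ j ∈ s, c i j * ‖a i - a j‖ ^ 2 =
      ∑ i ∈ s, ∑ j ∈ s, c i j * ‖a i‖ ^ 2 + ∑ i ∈ s, ∑ j ∈ s, c i j * ‖a j‖ ^ 2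
        - 2 * ∑ i ∈ s, ∑ j ∈ s, ⟪a i, a j⟫_ℝ * c i j := by
    simp only [Finset.mul_sum, ← Finset.sum_add_distrib, ← Finset.sum_sub_distrib]
    refine Finset.sum_congr rfl fun i _ => Finset.sum_congr rfl fun j _ => ?_
    rw [norm_sub_sq_real]; ring
  have h2 : ∑ i ∈ s, ∑ j ∈ s, c i j * ‖a j‖ ^ 2 = ∑ i ∈ s, ∑ j ∈ s, c i j * ‖a i‖ ^ 2 := by
    rw [Finset.sum_comm]
    exact Finset.sum_congr rfl fun i _ => Finset.sum_congr rfl fun j _ => by rw [hc]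
  simp only [Finset.sum_mul]
  rw [h1, h2]; ring

theorem sum_mul_inner_nonneg (s : Finset ι) (c : ι → ι → ℝ) (hc : ∀ i j, c i j = c j i)
    (hoff : ∀ i ∈ s, ∀ j ∈ s, i ≠ j → c i j ≤ 0) (hrow : ∀ i ∈ s, 0 ≤ ∑ j ∈ s, c i j)
    (a : ι → X) : 0 ≤ ∑ i ∈ s, ∑ j ∈ s, ⟪a i, a j⟫_ℝ * c i j := by
  rw [sum_mul_inner_eq s c hc a]
  have h1 : 0 ≤ ∑ i ∈ s, (∑ j ∈ s, c i j) * ‖a i‖ ^ 2 :=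
    Finset.sum_nonneg fun i hi => mul_nonneg (hrow i hi) (by positivity)
  have h2 : ∑ i ∈ s, ∑ j ∈ s, c i j * ‖a i - a j‖ ^ 2 ≤ 0 := by
    refine Finset.sum_nonpos fun i hi => Finset.sum_nonpos fun j hj => ?_
    rcases eq_or_ne i j with rfl | hij
    · simp
    · exact mul_nonpos_of_nonpos_of_nonneg (hoff i hi j hj hij) (by positivity)
  linarith

/-- Off the diagonal, `c i j ≤ 0` and `⟪a_i, a_j⟫ ≥ -(‖a_i‖² + ‖a_j‖²) / 2`; nonnegative row sums
let the diagonal absorb the resulting terms at the cost of a factor 2. -/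
theorem sum_mul_inner_le (s : Finset ι) (c : ι → ι → ℝ) (hc : ∀ i j, c i j = c j i)
    (hoff : ∀ i ∈ s, ∀ j ∈ s, i ≠ j → c i j ≤ 0) (hrow : ∀ i ∈ s, 0 ≤ ∑ j ∈ s, c i j)
    (a : ι → X) :
    ∑ i ∈ s, ∑ j ∈ s, ⟪a i, a j⟫_ℝ * c i j ≤ 2 * ∑ i ∈ s, c i i * ‖a i‖ ^ 2 := by
  classical
  -- The subtracted terms include `i = j`, so that full row sums appear; the doubled diagonal
  -- compensates, with equality there.
  have key : ∀ i ∈ s, ∀ j ∈ s, ⟪a i, a j⟫_ℝ * c i j ≤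
      (if i = j then 2 * (c i i * ‖a i‖ ^ 2) else 0)
        - c i j * (‖a i‖ ^ 2) / 2 - c i j * (‖a j‖ ^ 2) / 2 := by
    intro i hi j hj
    split_ifs with hij
    · subst hij
      rw [real_inner_self_eq_norm_sq]; linarith
    · have h := abs_le.1 (abs_real_inner_le_norm (a i) (a j))
      have h3 : -((‖a i‖ ^ 2 + ‖a j‖ ^ 2) / 2) ≤ ⟪a i, a j⟫_ℝ := by
        nlinarith [sq_nonneg (‖a i‖ - ‖a j‖)]
      nlinarith [mul_le_mul_of_nonpos_right h3 (hoff i hi j hj hij)]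
  have h2 : ∑ i ∈ s, ∑ j ∈ s, c i j * ‖a j‖ ^ 2 / 2 = ∑ i ∈ s, ∑ j ∈ s, c i j * ‖a i‖ ^ 2 / 2 := by
    rw [Finset.sum_comm]
    exact Finset.sum_congr rfl fun i _ => Finset.sum_congr rfl fun j _ => by rw [hc]
  have h1 : 0 ≤ ∑ i ∈ s, ∑ j ∈ s, c i j * ‖a i‖ ^ 2 / 2 := by
    refine Finset.sum_nonneg fun i hi => ?_
    rw [← Finset.sum_div, ← Finset.sum_mul]
    have := hrow i hi
    positivity
  calc _ ≤ ∑ i ∈ s, ∑ j ∈ s, ((if i = j then 2 * (c i i * ‖a i‖ ^ 2) else 0)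
        - c i j * (‖a i‖ ^ 2) / 2 - c i j * (‖a j‖ ^ 2) / 2) :=
        Finset.sum_le_sum fun i hi => Finset.sum_le_sum fun j hj => key i hi j hj
    _ = ∑ i ∈ s, 2 * (c i i * ‖a i‖ ^ 2) - ∑ i ∈ s, ∑ j ∈ s, c i j * ‖a i‖ ^ 2 / 2
        - ∑ i ∈ s, ∑ j ∈ s, c i j * ‖a j‖ ^ 2 / 2 := by
        simp only [Finset.sum_sub_distrib]
        congr 2
        exact Finset.sum_congr rfl fun i hi => by simp [hi]
    _ ≤ _ := by rw [h2, Finset.mul_sum]; linarith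

end Gram

/-! ### Step functions subordinate to a partition -/

namespace SimpleIntegrand

variable {T : ℝ} {X : Type*} [NormedAddCommGroup X] [InnerProductSpace ℝ X]

/-- `⟨·,·⟩_𝓜` as a bilinear form. -/
noncomputable def formM (H T : ℝ) (X : Type*) [NormedAddCommGroup X] [InnerProductSpace ℝ X] :
    LinearMap.BilinForm ℝ (SimpleIntegrand T X) :=
  Finsupp.lsum ℝ fun s => LinearMap.flip (Finsupp.lsum ℝ fun t =>
    LinearMap.flip (fbmCov H s t • innerₗ X))

theorem formM_apply (H : ℝ) (f g : SimpleIntegrand T X) : formM H T X f g = innerM H f g := by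
  simp only [formM, innerM, Finsupp.lsum_apply, Finsupp.sum, LinearMap.sum_apply,
    LinearMap.flip_apply, LinearMap.smul_apply, innerₗ_apply_apply, smul_eq_mul]
  exact Finset.sum_congr rfl fun i _ => Finset.sum_congr rfl fun j _ => mul_comm _ _

theorem fbmCov_comm (H s t : ℝ) : fbmCov H s t = fbmCov H t s := by
  simp only [fbmCov, abs_sub_comm s t]; ring

theorem formM_comm (H : ℝ) (f g : SimpleIntegrand T X) : formM H T X f g = formM H T X g f := by
  simp only [formM_apply, innerM, Finsupp.sum]
  rw [Finset.sum_comm]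
  exact Finset.sum_congr rfl fun i _ => Finset.sum_congr rfl fun j _ => by
    rw [real_inner_comm, fbmCov_comm]

/-- Evaluation of a simple function, as a linear map. -/
noncomputable def evalₗ (T : ℝ) (X : Type*) [NormedAddCommGroup X] [InnerProductSpace ℝ X] (t : ℝ) :
    SimpleIntegrand T X →ₗ[ℝ] X :=
  Finsupp.lsum ℝ fun s : Set.Ioc (0 : ℝ) T =>
    (Set.Ico (0 : ℝ) s).indicator (fun _ => (1 : ℝ)) t • LinearMap.id

theorem evalₗ_apply (t : ℝ) (g : SimpleIntegrand T X) : evalₗ T X t g = g.stepFun t := by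
  simp only [evalₗ, stepFun, Finsupp.lsum_apply, Finsupp.sum, LinearMap.smul_apply,
    LinearMap.id_apply]
  refine Finset.sum_congr rfl fun i _ => ?_
  by_cases h : t ∈ Set.Ico (0 : ℝ) i <;> simp [Set.indicator, h]

open Classical in
/-- The simple function `x 1_{[0,s)}`, for `0 ≤ s ≤ T`. -/
noncomputable def initial (T : ℝ) (X : Type*) [NormedAddCommGroup X] [InnerProductSpace ℝ X]
    (s : ℝ) : X →ₗ[ℝ] SimpleIntegrand T X :=
  if h : s ∈ Set.Ioc (0 : ℝ) T then Finsupp.lsingle ⟨s, h⟩ else 0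

/-- The endpoint `0` is allowed: `initial` is zero there, in agreement with `R(0,t) = 0`, which uses
`H > 0`. -/
theorem formM_initial {H : ℝ} (hH : 0 < H) {s t : ℝ} (hs : s ∈ Set.Icc 0 T) (ht : t ∈ Set.Icc 0 T)
    (x y : X) : formM H T X (initial T X s x) (initial T X t y) = ⟪x, y⟫_ℝ * fbmCov H s t := by
  have h0 : (0 : ℝ) ^ (2 * H) = 0 := Real.zero_rpow (by positivity)
  rcases hs.1.eq_or_lt with rfl | hs0
  · simp [initial, fbmCov, h0, abs_of_nonneg ht.1]
  rcases ht.1.eq_or_lt with rfl | ht0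
  · simp [initial, fbmCov, h0, abs_of_nonneg hs.1]
  rw [initial, initial, dif_pos ⟨hs0, hs.2⟩, dif_pos ⟨ht0, ht.2⟩]
  simp [formM_apply, innerM]

theorem evalₗ_initial {s : ℝ} (hs : s ∈ Set.Icc 0 T) (x : X) (t : ℝ) :
    evalₗ T X t (initial T X s x) = (Set.Ico (0 : ℝ) s).indicator (fun _ => x) t := by
  rcases hs.1.eq_or_lt with rfl | hs0
  · simp [initial]
  rw [initial, dif_pos ⟨hs0, hs.2⟩]
  simp [evalₗ_apply, stepFun]

/-- The simple function `∑_{j<N} a_j 1_{[t_j, t_{j+1})}`. -/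
noncomputable def ofPartition (T : ℝ) (X : Type*) [NormedAddCommGroup X] [InnerProductSpace ℝ X]
    (t : ℕ → ℝ) (N : ℕ) : (ℕ → X) →ₗ[ℝ] SimpleIntegrand T X :=
  ∑ j ∈ Finset.range N, (initial T X (t (j + 1)) - initial T X (t j)) ∘ₗ LinearMap.proj j

theorem ofPartition_apply (t : ℕ → ℝ) (N : ℕ) (a : ℕ → X) : ofPartition T X t N a =
    ∑ j ∈ Finset.range N, (initial T X (t (j + 1)) (a j) - initial T X (t j) (a j)) := by
  simp [ofPartition, LinearMap.sum_apply]

theorem ofPartition_two_mul (t : ℕ → ℝ) (N : ℕ) (a : ℕ → X) :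
    ofPartition T X t (2 * N) (fun j => a (j / 2)) = ofPartition T X (fun j => t (2 * j)) N a := by
  simp only [ofPartition_apply]
  induction N with
  | zero => simp
  | succ N ih =>
    rw [show 2 * (N + 1) = 2 * N + 1 + 1 by ring, Finset.sum_range_succ, Finset.sum_range_succ, ih,
      Finset.sum_range_succ, show (2 * N + 1) / 2 = N by omega, show 2 * N / 2 = N by omega,
      show 2 * (N + 1) = 2 * N + 1 + 1 by ring]
    abel

theorem formM_ofPartition {H : ℝ} (hH : 0 < H) {t : ℕ → ℝ} {N : ℕ}
    (ht : ∀ j ≤ N, t j ∈ Set.Icc 0 T) (a : ℕ → X) :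
    formM H T X (ofPartition T X t N a) (ofPartition T X t N a) =
      ∑ i ∈ Finset.range N, ∑ j ∈ Finset.range N,
        ⟪a i, a j⟫_ℝ * fbmIncCov H (t i) (t (i + 1)) (t j) (t (j + 1)) := by
  simp only [ofPartition_apply, map_sum, LinearMap.sum_apply]
  rw [Finset.sum_comm]
  refine Finset.sum_congr rfl fun i hi => Finset.sum_congr rfl fun j hj => ?_
  have hi' := Finset.mem_range.1 hi
  have hj' := Finset.mem_range.1 hj
  simp only [map_sub, LinearMap.sub_apply]
  rw [formM_initial hH (ht _ hi') (ht _ hj'), formM_initial hH (ht _ hi') (ht _ hj'.le),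
    formM_initial hH (ht _ hi'.le) (ht _ hj'), formM_initial hH (ht _ hi'.le) (ht _ hj'.le),
    fbmIncCov]
  ring

section Partition

variable {H : ℝ} {t : ℕ → ℝ} {N : ℕ}

theorem fbmIncCov_partition_nonpos (hH0 : 0 < H) (hH : H < 1 / 2) (hmono : Monotone t) {i j : ℕ}
    (hij : i ≠ j) : fbmIncCov H (t i) (t (i + 1)) (t j) (t (j + 1)) ≤ 0 := by
  rcases hij.lt_or_gt with h | h
  · exact fbmIncCov_nonpos hH0 hH (hmono i.le_succ) (hmono h) (hmono j.le_succ)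
  · rw [fbmIncCov_comm]
    exact fbmIncCov_nonpos hH0 hH (hmono j.le_succ) (hmono h) (hmono i.le_succ)

theorem sum_fbmIncCov_partition_nonneg (hH0 : 0 < H) (hmono : Monotone t) {i : ℕ} (hi : i < N) :
    0 ≤ ∑ j ∈ Finset.range N, fbmIncCov H (t i) (t (i + 1)) (t j) (t (j + 1)) := by
  rw [sum_fbmIncCov]
  exact fbmIncCov_nonneg_of_subset hH0 (hmono i.zero_le) (hmono i.le_succ) (hmono hi)

theorem formM_ofPartition_nonneg (hH0 : 0 < H) (hH : H < 1 / 2) (hmono : Monotone t)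
    (ht : ∀ j ≤ N, t j ∈ Set.Icc 0 T) (a : ℕ → X) :
    0 ≤ formM H T X (ofPartition T X t N a) (ofPartition T X t N a) := by
  rw [formM_ofPartition hH0 ht]
  exact sum_mul_inner_nonneg _ (fun i j => fbmIncCov H (t i) (t (i + 1)) (t j) (t (j + 1)))
    (fun i j => fbmIncCov_comm _ _ _ _ _)
    (fun i _ j _ hij => fbmIncCov_partition_nonpos hH0 hH hmono hij)
    (fun i hi => sum_fbmIncCov_partition_nonneg hH0 hmono (Finset.mem_range.1 hi)) a

theorem formM_ofPartition_le (hH0 : 0 < H) (hH : H < 1 / 2) (hmono : Monotone t)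
    (ht : ∀ j ≤ N, t j ∈ Set.Icc 0 T) (a : ℕ → X) :
    formM H T X (ofPartition T X t N a) (ofPartition T X t N a) ≤
      2 * ∑ j ∈ Finset.range N, (t (j + 1) - t j) ^ (2 * H) * ‖a j‖ ^ 2 := by
  rw [formM_ofPartition hH0 ht]
  refine (sum_mul_inner_le _ (fun i j => fbmIncCov H (t i) (t (i + 1)) (t j) (t (j + 1)))
    (fun i j => fbmIncCov_comm _ _ _ _ _)
    (fun i _ j _ hij => fbmIncCov_partition_nonpos hH0 hH hmono hij)
    (fun i hi => sum_fbmIncCov_partition_nonneg hH0 hmono (Finset.mem_range.1 hi)) a).trans_eq ?_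
  congr 1
  exact Finset.sum_congr rfl fun j _ => by rw [fbmIncCov_self hH0 (hmono j.le_succ)]

/-- Positivity of the form is available on the step functions of one partition, so Cauchy–Schwarz is
applied to its pullback to coefficient sequences. -/
theorem normM_add_le_of_partition (hH0 : 0 < H) (hH : H < 1 / 2) (hmono : Monotone t)
    (ht : ∀ j ≤ N, t j ∈ Set.Icc 0 T) {f g : SimpleIntegrand T X}
    (hf : f ∈ LinearMap.range (ofPartition T X t N))
    (hg : g ∈ LinearMap.range (ofPartition T X t N)) :
    (f + g).normM H ≤ f.normM H + g.normM H := by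
  obtain ⟨a, rfl⟩ := hf
  obtain ⟨b, rfl⟩ := hg
  have hpos := formM_ofPartition_nonneg (X := X) hH0 hH hmono ht
  have hcs := LinearMap.BilinForm.apply_sq_le_of_symm
    ((formM H T X).comp (ofPartition T X t N) (ofPartition T X t N)) hpos
    ⟨fun x y => formM_comm H _ _⟩ a b
  simp only [LinearMap.BilinForm.comp_apply] at hcs
  simp only [normM, ← formM_apply]
  set L := ofPartition T X t N
  rw [Real.sqrt_le_left (by positivity), add_sq, Real.sq_sqrt (hpos a), Real.sq_sqrt (hpos b)]
  have h : formM H T X (L a) (L b) ≤ √(formM H T X (L a) (L a)) * √(formM H T X (L b) (L b)) := by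
    rw [← Real.sqrt_mul (hpos a)]
    exact Real.le_sqrt_of_sq_le hcs
  simp only [map_add, LinearMap.add_apply]
  rw [formM_comm H (L b) (L a)]
  linarith

theorem stepFun_ofPartition (hmono : Monotone t) (ht : ∀ j ≤ N, t j ∈ Set.Icc 0 T) (a : ℕ → X)
    {k : ℕ} (hk : k < N) {r : ℝ} (hr : r ∈ Set.Ico (t k) (t (k + 1))) :
    (ofPartition T X t N a).stepFun r = a k := by
  have hr0 : 0 ≤ r := (ht k hk.le).1.trans hr.1
  rw [← evalₗ_apply, ofPartition_apply, map_sum, Finset.sum_eq_single k]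
  · rw [map_sub, evalₗ_initial (ht _ hk), evalₗ_initial (ht _ hk.le)]
    simp [Set.indicator, hr0, hr.2, not_lt.2 hr.1]
  · intro j hj hjk
    have hj' := Finset.mem_range.1 hj
    rw [map_sub, evalₗ_initial (ht _ hj'), evalₗ_initial (ht _ hj'.le)]
    rcases hjk.lt_or_gt with h | h
    · have h1 : t (j + 1) ≤ r := (hmono h).trans hr.1
      have h2 : t j ≤ r := (hmono j.le_succ).trans h1
      simp [Set.indicator, not_lt.2 h1, not_lt.2 h2]
    · have h1 : r < t j := hr.2.trans_le (hmono h)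
      have h2 : r < t (j + 1) := h1.trans_le (hmono j.le_succ)
      simp [Set.indicator, h1, h2]
  · exact fun h => absurd (Finset.mem_range.2 hk) h

end Partition

end SimpleIntegrand

/-! ### Dyadic approximation -/

/-- The dyadic points `T j / 2 ^ n`. -/
noncomputable def dyadicPoint (T : ℝ) (n j : ℕ) : ℝ := T * j / 2 ^ n

section Dyadic

variable {T : ℝ}

theorem monotone_dyadicPoint (hT : 0 ≤ T) (n : ℕ) : Monotone (dyadicPoint T n) := fun i j h => by
  unfold dyadicPoint; gcongr

theorem dyadicPoint_mem (hT : 0 ≤ T) (n : ℕ) : ∀ j ≤ 2 ^ n, dyadicPoint T n j ∈ Set.Icc 0 T := by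
  intro j hj
  refine ⟨by unfold dyadicPoint; positivity, ?_⟩
  rw [dyadicPoint, div_le_iff₀ (by positivity)]
  gcongr
  exact_mod_cast hj

theorem dyadicPoint_succ_two_mul (n j : ℕ) :
    dyadicPoint T (n + 1) (2 * j) = dyadicPoint T n j := by
  simp only [dyadicPoint]; push_cast; field_simp; ring

theorem dyadicPoint_succ_sub (n j : ℕ) :
    dyadicPoint T n (j + 1) - dyadicPoint T n j = T / 2 ^ n := by
  simp only [dyadicPoint]; push_cast; ring

theorem exists_mem_dyadic_Ico (hT : 0 < T) (n : ℕ) {r : ℝ} (hr : r ∈ Set.Ico 0 T) :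
    ∃ k < 2 ^ n, r ∈ Set.Ico (dyadicPoint T n k) (dyadicPoint T n (k + 1)) := by
  have h0 : 0 ≤ r * 2 ^ n / T := by have := hr.1; positivity
  refine ⟨⌊r * 2 ^ n / T⌋₊, ?_, ?_, ?_⟩
  · rw [Nat.floor_lt h0, div_lt_iff₀ hT]
    push_cast
    rw [mul_comm]
    have := hr.2
    gcongr
  · have h := Nat.floor_le h0
    rw [le_div_iff₀ hT] at h
    rw [dyadicPoint, div_le_iff₀ (by positivity)]
    linarith
  · have h := Nat.lt_floor_add_one (r * 2 ^ n / T)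
    rw [div_lt_iff₀ hT] at h
    rw [dyadicPoint, lt_div_iff₀ (by positivity)]
    push_cast
    linarith

theorem sum_range_inv_sq_le (N : ℕ) : ∑ j ∈ Finset.range N, ((1 : ℝ) / (j + 1)) ^ 2 ≤ 2 := by
  -- Strengthened for the induction, which telescopes `1/N - 1/(N+1)`; at `N = 0` the term `1/N` is
  -- zero.
  have h : ∀ N : ℕ, ∑ j ∈ Finset.range N, ((1 : ℝ) / ((j : ℝ) + 1)) ^ 2 ≤ 2 - 1 / (N : ℝ) := by
    intro N
    induction N with
    | zero => simp
    | succ N ih =>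
      rw [Finset.sum_range_succ]
      rcases N.eq_zero_or_pos with rfl | hN
      · norm_num
      have hN' : (0 : ℝ) < N := by exact_mod_cast hN
      have key : ((1 : ℝ) / (N + 1)) ^ 2 ≤ 1 / (N : ℝ) - 1 / ((N : ℝ) + 1) := by
        rw [div_sub_div _ _ hN'.ne' (by positivity), div_pow,
          div_le_div_iff₀ (by positivity) (by positivity)]
        nlinarith
      push_cast
      linarith
  exact (h N).trans (by linarith [show (0 : ℝ) ≤ 1 / (N : ℝ) by positivity])

end Dyadic

namespace SimpleIntegrand

variable {T H : ℝ} {X : Type*} [NormedAddCommGroup X] [InnerProductSpace ℝ X]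

/-- The step function on the dyadic grid that takes on each cell the value of `f` at its right
endpoint. -/
noncomputable def dyadic (T : ℝ) (f : ℝ → X) (n : ℕ) : SimpleIntegrand T X :=
  ofPartition T X (dyadicPoint T n) (2 ^ n) fun j => f (dyadicPoint T n (j + 1))

theorem ofPartition_dyadic_succ (n : ℕ) (a : ℕ → X) :
    ofPartition T X (dyadicPoint T (n + 1)) (2 ^ (n + 1)) (fun j => a (j / 2)) =
      ofPartition T X (dyadicPoint T n) (2 ^ n) a := by
  rw [pow_succ', ofPartition_two_mul]
  simp only [dyadicPoint_succ_two_mul]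

theorem range_ofPartition_dyadic_mono :
    Monotone fun n => LinearMap.range (ofPartition T X (dyadicPoint T n) (2 ^ n)) := by
  refine monotone_nat_of_le_succ fun n => ?_
  rintro _ ⟨a, rfl⟩
  exact ⟨_, ofPartition_dyadic_succ n a⟩

/-- Both levels are step functions on the finer grid, so the diagonal bound applies with cell length
`T / 2 ^ (n + 1)`. Right endpoints keep every sample away from `0`, where `f` is not controlled. -/
theorem normM_dyadic_succ_sub_le (hH0 : 0 < H) (hH : H < 1 / 2) (hT : 0 < T) {f : ℝ → X} {K : ℝ}
    (hK : 0 ≤ K)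
    (hf : ∀ s t, 0 < s → s ≤ t → t ≤ T → ‖f t - f s‖ ≤ K * ((t - s) / s)) (n : ℕ) :
    (dyadic T f (n + 1) - dyadic T f n).normM H ≤ 2 * K * (T / 2 ^ (n + 1)) ^ H := by
  rw [dyadic, dyadic, ← ofPartition_dyadic_succ n, ← map_sub, normM, ← formM_apply]
  refine Real.sqrt_le_iff.2 ⟨by positivity, ?_⟩
  refine (formM_ofPartition_le hH0 hH (monotone_dyadicPoint hT.le _)
    (dyadicPoint_mem hT.le _) _).trans ?_
  have hd : ∀ j ∈ Finset.range (2 ^ (n + 1)),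
      ‖f (dyadicPoint T (n + 1) (j + 1)) - f (dyadicPoint T n (j / 2 + 1))‖ ≤ K * (1 / (j + 1)) := by
    intro j hj
    have hj' := Finset.mem_range.1 hj
    rw [← dyadicPoint_succ_two_mul (T := T) n]
    -- On an even fine cell the two right endpoints are `j + 1` and `j + 2` cells from `0`, whence
    -- the ratio `1 / (j + 1)`; on an odd cell they coincide.
    rcases Nat.even_or_odd' j with ⟨m, rfl | rfl⟩
    · rw [show 2 * (2 * m / 2 + 1) = 2 * m + 1 + 1 by omega, norm_sub_rev]
      have hs : 0 < dyadicPoint T (n + 1) (2 * m + 1) := by unfold dyadicPoint; positivity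
      refine (hf _ _ hs (monotone_dyadicPoint hT.le _ (Nat.le_succ _))
        (dyadicPoint_mem hT.le (n + 1) _ ?_).2).trans_eq ?_
      · rw [pow_succ'] at hj' ⊢; omega
      · rw [dyadicPoint_succ_sub, dyadicPoint]
        push_cast
        field_simp
    · rw [show 2 * ((2 * m + 1) / 2 + 1) = 2 * m + 1 + 1 by omega, sub_self, norm_zero]
      positivity
  have e : ((T / 2 ^ (n + 1)) ^ H) ^ 2 = (T / 2 ^ (n + 1)) ^ (2 * H) := by
    rw [← Real.rpow_natCast, ← Real.rpow_mul (by positivity), mul_comm]; norm_num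
  calc _ ≤ 2 * ∑ j ∈ Finset.range (2 ^ (n + 1)),
        (T / 2 ^ (n + 1)) ^ (2 * H) * (K * (1 / ((j : ℝ) + 1))) ^ 2 := by
        simp only [dyadicPoint_succ_sub]
        gcongr with j hj
        exact hd j hj
    _ = 2 * (T / 2 ^ (n + 1)) ^ (2 * H) * K ^ 2 *
        ∑ j ∈ Finset.range (2 ^ (n + 1)), ((1 : ℝ) / (j + 1)) ^ 2 := by
        rw [Finset.mul_sum, Finset.mul_sum]
        exact Finset.sum_congr rfl fun j _ => by ring
    _ ≤ 2 * (T / 2 ^ (n + 1)) ^ (2 * H) * K ^ 2 * 2 := by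
        gcongr; exact sum_range_inv_sq_le _
    _ = _ := by rw [mul_pow, e]; ring

theorem normM_sub_comm (f g : SimpleIntegrand T X) : (f - g).normM H = (g - f).normM H := by
  rw [normM, normM, ← formM_apply, ← formM_apply, ← neg_sub g f,
    map_neg, map_neg, LinearMap.neg_apply, neg_neg]

/-- Each triangle inequality is taken on the finest grid involved, which contains all coarser ones.
The exact geometric sum makes the induction close. -/
theorem normM_dyadic_sub_le (hH0 : 0 < H) (hH : H < 1 / 2) (hT : 0 < T) {f : ℝ → X} {c r : ℝ}
    (hr : r ≠ 1)
    (hf : ∀ n, (dyadic T f (n + 1) - dyadic T f n).normM H ≤ c * r ^ n) (n k : ℕ) :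
    (dyadic T f (n + k) - dyadic T f n).normM H ≤ c / (1 - r) * (r ^ n - r ^ (n + k)) := by
  induction k with
  | zero => simp [normM, innerM]
  | succ k ih =>
    have hmem : ∀ m ≤ n + k + 1, dyadic T f m ∈ LinearMap.range
        (ofPartition T X (dyadicPoint T (n + k + 1)) (2 ^ (n + k + 1))) := fun m hm =>
      range_ofPartition_dyadic_mono hm ⟨_, rfl⟩
    have h := normM_add_le_of_partition hH0 hH (monotone_dyadicPoint hT.le (n + k + 1))
      (dyadicPoint_mem hT.le _)
      (sub_mem (hmem _ le_rfl) (hmem (n + k) (by omega)))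
      (sub_mem (hmem (n + k) (by omega)) (hmem n (by omega)))
    rw [sub_add_sub_cancel] at h
    have hr' : 1 - r ≠ 0 := sub_ne_zero.2 hr.symm
    calc _ ≤ c * r ^ (n + k) + c / (1 - r) * (r ^ n - r ^ (n + k)) :=
          h.trans (add_le_add (hf _) ih)
      _ = _ := by rw [← add_assoc, pow_succ r (n + k)]; field_simp; ring

end SimpleIntegrand

/-! ### Convergence in `L²` and a criterion for membership in `𝓜` -/

theorem SimpleIntegrand.stronglyMeasurable_stepFun {T : ℝ} {X : Type*} [NormedAddCommGroup X]
    (g : SimpleIntegrand T X) : StronglyMeasurable g.stepFun := by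
  unfold stepFun Finsupp.sum
  exact Finset.stronglyMeasurable_fun_sum _ fun s _ =>
    stronglyMeasurable_const.indicator measurableSet_Ico

open SimpleIntegrand

theorem tendsto_eLpNorm_sub_of_bounded {α E : Type*} [MeasurableSpace α] {μ : Measure α}
    [IsFiniteMeasure μ] [NormedAddCommGroup E] {f : α → E} {g : ℕ → α → E} {B : ℝ}
    (hf : AEStronglyMeasurable f μ) (hg : ∀ n, AEStronglyMeasurable (g n) μ)
    (hB : ∀ n, ∀ᵐ x ∂μ, ‖f x - g n x‖ ≤ B)
    (hlim : ∀ᵐ x ∂μ, Tendsto (fun n => g n x) atTop (𝓝 (f x))) :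
    Tendsto (fun n => eLpNorm (fun x => f x - g n x) 2 μ) atTop (𝓝 0) := by
  have h2 : ((2 : ENNReal).toReal) = 2 := by norm_num
  have key : Tendsto (fun n => ∫⁻ x, ‖f x - g n x‖ₑ ^ (2 : ℝ) ∂μ) atTop (𝓝 (∫⁻ _, 0 ∂μ)) := by
    refine tendsto_lintegral_of_dominated_convergence' (fun _ => ENNReal.ofReal B ^ (2 : ℝ))
      (fun n => (hf.sub (hg n)).enorm.pow_const _) (fun n => ?_) ?_ ?_
    · filter_upwards [hB n] with x hx
      gcongr
      rw [← ofReal_norm]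
      exact ENNReal.ofReal_le_ofReal hx
    · rw [lintegral_const]
      exact ENNReal.mul_ne_top (by simp) (measure_ne_top _ _)
    · filter_upwards [hlim] with x hx
      have h : Tendsto (fun n => ‖f x - g n x‖ₑ) atTop (𝓝 0) := by
        simpa using (hx.const_sub (f x)).enorm
      simpa using h.ennrpow_const 2
  rw [lintegral_zero] at key
  simp only [eLpNorm_eq_lintegral_rpow_enorm_toReal (μ := μ) two_ne_zero ENNReal.ofNat_ne_top, h2]
  simpa using key.ennrpow_const (1 / 2)

theorem continuousOn_of_norm_sub_le_div {X : Type*} [NormedAddCommGroup X] {T K : ℝ} {f : ℝ → X}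
    (hK : 0 ≤ K)
    (hf : ∀ s t, 0 < s → s ≤ t → t ≤ T → ‖f t - f s‖ ≤ K * ((t - s) / s)) :
    ContinuousOn f (Set.Ioc 0 T) := by
  intro r hr
  have hr0 := hr.1
  -- Whichever of `s` and `r` is smaller exceeds `r / 2`, so one denominator serves both orders.
  have hbound : ∀ s ∈ Set.Ioc 0 T, r / 2 < s → ‖f s - f r‖ ≤ K * (|s - r| / (r / 2)) := by
    intro s hs hsr
    rcases le_total s r with h | h
    · rw [norm_sub_rev, abs_sub_comm, abs_of_nonneg (sub_nonneg.2 h)]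
      refine (hf s r hs.1 h hr.2).trans ?_
      have := sub_nonneg.2 h
      gcongr
    · rw [abs_of_nonneg (sub_nonneg.2 h)]
      refine (hf r s hr.1 h hs.2).trans ?_
      have := sub_nonneg.2 h
      gcongr
      linarith
  have hlim : Tendsto (fun s => K * (|s - r| / (r / 2))) (𝓝[Set.Ioc 0 T] r) (𝓝 0) := by
    have : Continuous fun s => K * (|s - r| / (r / 2)) := by fun_prop
    simpa using (this.tendsto r).mono_left nhdsWithin_le_nhds
  rw [ContinuousWithinAt, tendsto_iff_norm_sub_tendsto_zero]
  refine squeeze_zero' (Eventually.of_forall fun _ => norm_nonneg _) ?_ hlim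
  filter_upwards [self_mem_nhdsWithin,
    mem_nhdsWithin_of_mem_nhds (lt_mem_nhds (show r / 2 < r by linarith))] with s hs hsr
  exact hbound s hs hsr

/-- A bounded function on `(0,T]` whose increments satisfy `|f t - f s| ≤ K (t - s) / s` belongs
to `𝓜`. -/
theorem memM_of_norm_sub_le_div {X : Type*} [NormedAddCommGroup X] [InnerProductSpace ℝ X]
    {H T K B : ℝ} (hH0 : 0 < H) (hH : H < 1 / 2) (hT : 0 < T) (hK : 0 ≤ K) {f : ℝ → X}
    (hB : ∀ t ∈ Set.Ioc 0 T, ‖f t‖ ≤ B)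
    (hf : ∀ s t, 0 < s → s ≤ t → t ≤ T → ‖f t - f s‖ ≤ K * ((t - s) / s)) : MemM H T f := by
  have hcont := continuousOn_of_norm_sub_le_div hK hf
  -- The endpoints are null: nothing is assumed of `f` at `0`, and the half-open dyadic cells miss
  -- `T`.
  have hIoo : ∀ᵐ t ∂(volume.restrict (Set.Icc 0 T)), t ∈ Set.Ioo 0 T := by
    rw [← restrict_Ioo_eq_restrict_Icc]
    exact ae_restrict_mem measurableSet_Ioo
  have hmeas : AEStronglyMeasurable f (volume.restrict (Set.Icc 0 T)) := by
    rw [← restrict_Ioc_eq_restrict_Icc]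
    exact hcont.aestronglyMeasurable measurableSet_Ioc
  refine ⟨MemLp.of_bound hmeas B ?_, dyadic T f, ?_, ?_⟩
  · filter_upwards [hIoo] with t ht using hB t ⟨ht.1, ht.2.le⟩
  · have hr0 : (0 : ℝ) ≤ (1 / 2) ^ H := by positivity
    have hr1 : ((1 : ℝ) / 2) ^ H < 1 := Real.rpow_lt_one (by norm_num) (by norm_num) hH0
    set r := ((1 : ℝ) / 2) ^ H with hr
    have hstep : ∀ n, (dyadic T f (n + 1) - dyadic T f n).normM H ≤ 2 * K * (T / 2) ^ H * r ^ n := by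
      intro n
      refine (normM_dyadic_succ_sub_le hH0 hH hT hK hf n).trans_eq ?_
      have e : T / 2 ^ (n + 1) = T / 2 * (1 / 2) ^ n := by
        rw [pow_succ, div_pow, one_pow]
        field_simp
      rw [hr, Real.rpow_pow_comm (by norm_num), e, Real.mul_rpow (by positivity) (by positivity),
        mul_assoc (2 * K)]
    have hle : ∀ n k, (dyadic T f (n + k) - dyadic T f n).normM H ≤
        2 * K * (T / 2) ^ H / (1 - r) * r ^ n := fun n k => by
      refine (normM_dyadic_sub_le hH0 hH hT hr1.ne hstep n k).trans ?_
      have : 0 ≤ 1 - r := by linarith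
      gcongr
      linarith [pow_nonneg hr0 (n + k)]
    have hlim : Tendsto (fun n => 2 * K * (T / 2) ^ H / (1 - r) * r ^ n) atTop (𝓝 0) := by
      simpa using (tendsto_pow_atTop_nhds_zero_of_lt_one hr0 hr1).const_mul
        (2 * K * (T / 2) ^ H / (1 - r))
    intro ε hε
    obtain ⟨N, hN⟩ := eventually_atTop.1 (hlim.eventually (gt_mem_nhds hε))
    refine ⟨N, fun m hm n hn => ?_⟩
    rcases le_total n m with h | h
    · obtain ⟨k, rfl⟩ := Nat.exists_eq_add_of_le h
      exact (hle n k).trans_lt (hN n hn)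
    · obtain ⟨k, rfl⟩ := Nat.exists_eq_add_of_le h
      rw [normM_sub_comm]
      exact (hle m k).trans_lt (hN m hm)
  · have hval : ∀ t ∈ Set.Ioo 0 T, ∀ n, ∃ s ∈ Set.Ioc 0 T, t ≤ s ∧ s - t ≤ T / 2 ^ n ∧
        (dyadic T f n).stepFun t = f s := by
      intro t ht n
      obtain ⟨k, hk, hkt⟩ := exists_mem_dyadic_Ico hT n ⟨ht.1.le, ht.2⟩
      refine ⟨dyadicPoint T n (k + 1), ⟨ht.1.trans hkt.2, (dyadicPoint_mem hT.le n _ hk).2⟩,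
        hkt.2.le, ?_, stepFun_ofPartition (monotone_dyadicPoint hT.le n)
          (dyadicPoint_mem hT.le n) _ hk hkt⟩
      rw [← dyadicPoint_succ_sub n k]
      linarith [hkt.1]
    refine tendsto_eLpNorm_sub_of_bounded (B := B + B) hmeas
      (fun n => (stronglyMeasurable_stepFun _).aestronglyMeasurable) (fun n => ?_) ?_
    · filter_upwards [hIoo] with t ht
      obtain ⟨s, hs, -, -, h⟩ := hval t ht n
      rw [h]
      exact (norm_sub_le _ _).trans (add_le_add (hB t ⟨ht.1, ht.2.le⟩) (hB s hs))
    · filter_upwards [hIoo] with t ht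
      rw [tendsto_iff_norm_sub_tendsto_zero]
      have hlim : Tendsto (fun n : ℕ => K * (T / 2 ^ n / t)) atTop (𝓝 0) := by
        have := (tendsto_pow_atTop_nhds_zero_of_lt_one (r := (1 / 2 : ℝ)) (by norm_num)
          (by norm_num)).const_mul (K * T / t)
        rw [mul_zero] at this
        refine this.congr fun n => ?_
        rw [div_pow, one_pow]; ring
      refine squeeze_zero (fun _ => norm_nonneg _) (fun n => ?_) hlim
      obtain ⟨s, hs, hts, hst, h⟩ := hval t ht n
      rw [h]
      refine (hf t s ht.1 hts hs.2).trans ?_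
      have := ht.1
      gcongr

/-! ### Lipschitz estimates for analytic semigroups -/

section Sector

theorem mem_complexSector_ofReal {δ : ℝ} (hδ : 0 < δ) {t : ℝ} (ht : 0 < t) :
    (t : ℂ) ∈ complexSector δ := by
  refine ⟨by exact_mod_cast ht.ne', ?_⟩
  rwa [Complex.arg_ofReal_of_nonneg ht.le, abs_zero]

theorem isOpen_complexSector {δ : ℝ} (hδ : δ ≤ Real.pi / 2) : IsOpen (complexSector δ) := by
  rw [isOpen_iff_mem_nhds]
  rintro z ⟨hz, harg⟩
  have hslit : z ∈ Complex.slitPlane := by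
    rw [Complex.mem_slitPlane_iff_arg]
    refine ⟨fun h => ?_, hz⟩
    rw [h, abs_of_pos Real.pi_pos] at harg
    linarith [Real.pi_pos]
  have h1 : ∀ᶠ w in 𝓝 z, |w.arg| < δ :=
    (Complex.continuousAt_arg hslit).abs.eventually (gt_mem_nhds harg)
  filter_upwards [h1, isOpen_ne.mem_nhds hz] with w hw hw0 using ⟨hw0, hw⟩

theorem smul_mem_complexSector {δ : ℝ} {z : ℂ} (hz : z ∈ complexSector δ) {r : ℝ} (hr : 0 < r) :
    (r : ℂ) * z ∈ complexSector δ :=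
  ⟨mul_ne_zero (by exact_mod_cast hr.ne') hz.1, by rw [Complex.arg_real_mul _ hr]; exact hz.2⟩

/-- Around the positive real axis, the sector contains balls of radius proportional to the
centre. -/
theorem exists_closedBall_subset_complexSector {δ : ℝ} (hδ0 : 0 < δ) (hδ : δ ≤ Real.pi / 2) :
    ∃ c : ℝ, 0 < c ∧ c ≤ 1 ∧
      ∀ s : ℝ, 0 < s → Metric.closedBall (s : ℂ) (c * s) ⊆ complexSector δ := by
  have h1 : complexSector δ ∈ 𝓝 ((1 : ℝ) : ℂ) :=
    (isOpen_complexSector hδ).mem_nhds (mem_complexSector_ofReal hδ0 one_pos)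
  obtain ⟨ε, hε, hball⟩ := Metric.nhds_basis_closedBall.mem_iff.1 h1
  -- The sector is invariant under positive dilations, so a ball around `1` scales to one around
  -- `s`.
  refine ⟨min ε 1, by positivity, min_le_right _ _, fun s hs z hz => ?_⟩
  have hz1 : ((s⁻¹ : ℝ) : ℂ) * z ∈ complexSector δ := by
    refine hball ?_
    rw [mem_closedBall_iff_norm] at hz ⊢
    have : ((s⁻¹ : ℝ) : ℂ) * z - ((1 : ℝ) : ℂ) = ((s⁻¹ : ℝ) : ℂ) * (z - s) := by
      have : (s : ℂ) ≠ 0 := by exact_mod_cast hs.ne'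
      push_cast; field_simp
    rw [this, norm_mul, Complex.norm_real, Real.norm_of_nonneg (by positivity)]
    calc s⁻¹ * ‖z - s‖ ≤ s⁻¹ * (min ε 1 * s) := by gcongr
      _ = min ε 1 := by field_simp
      _ ≤ ε := min_le_left _ _
  have := smul_mem_complexSector hz1 hs
  rwa [← mul_assoc, ← Complex.ofReal_mul, mul_inv_cancel₀ hs.ne', Complex.ofReal_one,
    one_mul] at this

end Sector

section Semigroup

/-- Operators that converge strongly along a countably generated filter are eventually uniformly
bounded. -/
theorem exists_eventually_norm_le_of_tendsto {ι W : Type*} [NormedAddCommGroup W] [NormedSpace ℂ W]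
    [CompleteSpace W] {l : Filter ι} [l.IsCountablyGenerated] {E : ι → W →L[ℂ] W}
    {A : W → W} (hE : ∀ x, Tendsto (fun z => E z x) l (𝓝 (A x))) :
    ∃ M : ℝ, ∀ᶠ z in l, ‖E z‖ ≤ M := by
  -- Along the filter, boundedness of `E z x` is only eventual and depends on `x`. A sequence with
  -- `‖E (z n)‖ > n` has bounded orbits over all `n`, which contradicts Banach–Steinhaus.
  by_contra! hcon
  obtain ⟨s, hs⟩ := l.exists_antitone_basis
  have hex : ∀ n : ℕ, ∃ z ∈ s n, (n : ℝ) < ‖E z‖ := fun n => by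
    obtain ⟨z, hz, hz'⟩ := ((hcon n).and_eventually (hs.1.mem_of_mem (i := n) trivial)).exists
    exact ⟨z, hz', hz⟩
  choose z hz hzn using hex
  have hzl : Tendsto z atTop l := hs.tendsto hz
  obtain ⟨M, hM⟩ := banach_steinhaus (g := fun n => E (z n)) fun x => by
    obtain ⟨B, hB⟩ := ((hE x).comp hzl).norm.bddAbove_range
    exact ⟨B, fun n => hB ⟨n, rfl⟩⟩
  obtain ⟨n, hn⟩ := exists_nat_gt M
  linarith [hM n, hzn n]

variable {V : Type*} [NormedAddCommGroup V] [NormedSpace ℝ V]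

theorem Complexification.norm_ofReal (x : V) : ‖ofReal x‖ = ‖x‖ := by
  change ‖Complex.reCLM.smulRight x‖ = ‖x‖
  rw [ContinuousLinearMap.norm_smulRight_apply, Complex.reCLM_norm, one_mul]

theorem ContinuousLinearMap.complexify_ofReal (A : V →L[ℝ] V) (x : V) :
    A.complexify (Complexification.ofReal x) = Complexification.ofReal (A x) :=
  Complexification.ext' fun z => A.map_smul z.re x

/-- The embedding of `V` is isometric and intertwines each operator with its complexification, so
bounds for `E` descend to `S`. -/
theorem ContinuousLinearMap.norm_sub_le_complexify (A B : V →L[ℝ] V) :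
    ‖A - B‖ ≤ ‖A.complexify - B.complexify‖ := by
  refine opNorm_le_bound _ (norm_nonneg _) fun x => ?_
  have h := (A.complexify - B.complexify).le_opNorm (Complexification.ofReal x)
  have h2 : (A.complexify - B.complexify) (Complexification.ofReal x)
      = Complexification.ofReal ((A - B) x) := by
    rw [sub_apply, complexify_ofReal, complexify_ofReal]
    exact Complexification.ext' fun z => (smul_sub z.re (A x) (B x)).symm
  rwa [h2, Complexification.norm_ofReal, Complexification.norm_ofReal] at h

theorem norm_sub_le_of_norm_deriv_ofReal_le {F : Type*} [NormedAddCommGroup F] [NormedSpace ℂ F]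
    {f : ℂ → F} {s t C : ℝ} (hst : s ≤ t) (hd : ∀ r ∈ Set.Icc s t, DifferentiableAt ℂ f r)
    (hC : ∀ r ∈ Set.Icc s t, ‖deriv f r‖ ≤ C) : ‖f t - f s‖ ≤ C * (t - s) := by
  have hderiv : ∀ r ∈ Set.Icc s t,
      HasDerivWithinAt (fun r : ℝ => f r) (deriv f r) (Set.Icc s t) r := fun r hr => by
    simpa [Function.comp_def] using
      ((hd r hr).hasDerivAt.scomp r Complex.ofRealCLM.hasDerivAt).hasDerivWithinAt
  have h := (convex_Icc s t).norm_image_sub_le_of_norm_hasDerivWithin_le hderiv hC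
    (Set.left_mem_Icc.2 hst) (Set.right_mem_Icc.2 hst)
  rwa [Real.norm_of_nonneg (sub_nonneg.2 hst)] at h

/-- Near `0`, strong convergence bounds `E` uniformly, and Cauchy's estimate on a circle of radius
`c * s` gives `M / (c * s)`. On `[ρ/2, T]`, compactness bounds the continuous derivative. -/
theorem exists_norm_deriv_le_div {W : Type*} [NormedAddCommGroup W] [NormedSpace ℂ W]
    [CompleteSpace W] {δ : ℝ} (hδ0 : 0 < δ) (hδ : δ ≤ Real.pi / 2) {E : ℂ → W →L[ℂ] W}
    (hE : DifferentiableOn ℂ E (complexSector δ))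
    (hE0 : ∀ x, Tendsto (fun z => E z x) (𝓝[complexSector δ] 0) (𝓝 x)) (T : ℝ) :
    ∃ K : ℝ, 0 ≤ K ∧ ∀ s : ℝ, 0 < s → s ≤ T → ‖deriv E s‖ ≤ K / s := by
  obtain ⟨M, hM⟩ := exists_eventually_norm_le_of_tendsto (A := id) hE0
  rw [eventually_nhdsWithin_iff, Metric.eventually_nhds_iff] at hM
  obtain ⟨ρ, hρ, hM⟩ := hM
  obtain ⟨c, hc0, hc1, hc⟩ := exists_closedBall_subset_complexSector hδ0 hδ
  have hsmall : ∀ s : ℝ, 0 < s → s < ρ / 2 → ‖deriv E s‖ ≤ M / (c * s) := by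
    intro s hs hsρ
    refine Complex.norm_deriv_le_of_forall_mem_sphere_norm_le (by positivity) ?_ fun z hz => ?_
    · exact (hE.mono (hc s hs)).diffContOnCl_ball subset_rfl
    · refine hM ?_ (hc s hs (Metric.sphere_subset_closedBall hz))
      rw [mem_sphere_iff_norm] at hz
      rw [dist_zero_right]
      calc ‖z‖ = ‖(z - s) + s‖ := by rw [sub_add_cancel]
        _ ≤ ‖z - s‖ + ‖(s : ℂ)‖ := norm_add_le _ _
        _ = c * s + s := by rw [hz, Complex.norm_real, Real.norm_of_nonneg hs.le]
        -- As `c ≤ 1`, the circle stays within distance `2 * s < ρ` of the origin.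
        _ ≤ 1 * s + s := by gcongr
        _ < ρ := by linarith
  have hcont : ContinuousOn (fun s : ℝ => deriv E s) (Set.Icc (ρ / 2) T) := by
    refine (hE.deriv (isOpen_complexSector hδ)).continuousOn.comp
      Complex.continuous_ofReal.continuousOn fun s hs => ?_
    exact mem_complexSector_ofReal hδ0 (by linarith [hs.1])
  obtain ⟨B, hB⟩ := isCompact_Icc.exists_bound_of_continuousOn hcont
  refine ⟨max (max (M / c) (B * T)) 0, le_max_right _ _, fun s hs hsT => ?_⟩
  rcases lt_or_ge s (ρ / 2) with h | h
  · refine (hsmall s hs h).trans ?_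
    rw [← div_div]
    gcongr
    exact (le_max_left _ _).trans (le_max_left _ _)
  · have hb := hB s ⟨h, hsT⟩
    rw [le_div_iff₀ hs]
    calc ‖deriv E s‖ * s ≤ B * T :=
          mul_le_mul hb hsT hs.le ((norm_nonneg _).trans hb)
      _ ≤ _ := (le_max_right _ _).trans (le_max_left _ _)

theorem IsAnalyticSemigroup.exists_norm_sub_le [CompleteSpace V] {S : ℝ → V →L[ℝ] V}
    (hS : IsAnalyticSemigroup S) (T : ℝ) :
    ∃ K : ℝ, 0 ≤ K ∧ ∀ s t : ℝ, 0 < s → s ≤ t → t ≤ T → ‖S t - S s‖ ≤ K * ((t - s) / s) := by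
  obtain ⟨-, δ, hδ0, hδ, E, hES, hE, -, hE0⟩ := hS
  obtain ⟨K, hK0, hK⟩ := exists_norm_deriv_le_div hδ0 hδ hE hE0 T
  refine ⟨K, hK0, fun s t hs hst htT => ?_⟩
  refine (ContinuousLinearMap.norm_sub_le_complexify _ _).trans ?_
  rw [← hES s hs, ← hES t (hs.trans_le hst)]
  have hd : ∀ r ∈ Set.Icc s t, DifferentiableAt ℂ E r := fun r hr => hE.differentiableAt
    ((isOpen_complexSector hδ).mem_nhds (mem_complexSector_ofReal hδ0 (hs.trans_le hr.1)))
  refine (norm_sub_le_of_norm_deriv_ofReal_le (C := K / s) hst hd fun r hr => ?_).trans_eq (by ring)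
  exact (hK r (hs.trans_le hr.1) (hr.2.trans htT)).trans (div_le_div_of_nonneg_left hK0 hs hr.1)

theorem HasNegativeType.exists_norm_le {S : ℝ → V →L[ℝ] V} (hS : HasNegativeType S) :
    ∃ M : ℝ, ∀ t, 0 ≤ t → ‖S t‖ ≤ M := by
  obtain ⟨M, ω, hω, hM⟩ := hS
  have hM0 : 0 ≤ M := by simpa using (norm_nonneg _).trans (hM 0 le_rfl)
  refine ⟨M, fun t ht => (hM t ht).trans (mul_le_of_le_one_right hM0 ?_)⟩
  exact Real.exp_le_one_iff.2 (mul_nonpos_of_nonpos_of_nonneg hω.le ht)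

end Semigroup

/-! ### Transfer to the adjoint and conclusion -/

section HilbertAdjoint

variable {X U : Type*} [NormedAddCommGroup X] [InnerProductSpace ℝ X] [CompleteSpace X]
  [NormedAddCommGroup U] [NormedSpace ℝ U]

theorem norm_hilbertAdjoint_le (i : X →L[ℝ] U) (u : StrongDual ℝ U) :
    ‖hilbertAdjoint i u‖ ≤ ‖u‖ * ‖i‖ := by
  rw [hilbertAdjoint, LinearIsometryEquiv.norm_map]
  exact u.opNorm_comp_le i

theorem hilbertAdjoint_sub (i : X →L[ℝ] U) (u w : StrongDual ℝ U) :
    hilbertAdjoint i (u - w) = hilbertAdjoint i u - hilbertAdjoint i w := by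
  rw [hilbertAdjoint, ContinuousLinearMap.sub_comp, map_sub]; rfl

end HilbertAdjoint

theorem proposition6p4
    {X U V : Type*}
    [NormedAddCommGroup X] [InnerProductSpace ℝ X] [CompleteSpace X]
    [TopologicalSpace.SeparableSpace X]
    [NormedAddCommGroup U] [NormedSpace ℝ U] [CompleteSpace U]
    [TopologicalSpace.SeparableSpace U]
    [NormedAddCommGroup V] [NormedSpace ℝ V] [CompleteSpace V]
    [TopologicalSpace.SeparableSpace V]
    (H : ℝ) (hH0 : 0 < H) (hH : H < 1 / 2) (T : ℝ) (hT : 0 < T)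
    (i : X →L[ℝ] U) (C : U →L[ℝ] V) (S : ℝ → V →L[ℝ] V)
    (hS : IsAnalyticSemigroup S) (hneg : HasNegativeType S) :
    MemIntegrandClass H T i (fun t => S t ∘L C) := by
  intro v
  obtain ⟨K, hK0, hK⟩ := hS.exists_norm_sub_le T
  obtain ⟨M, hM⟩ := hneg.exists_norm_le
  -- The map `A ↦ i* C* A* v*` is linear and bounded, so this one estimate carries over both the
  -- bound on `S t` and the increment bound.
  have hle : ∀ A : V →L[ℝ] V, ‖hilbertAdjoint i (v ∘L (A ∘L C))‖ ≤ ‖v‖ * ‖C‖ * ‖i‖ * ‖A‖ := by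
    intro A
    calc _ ≤ ‖v ∘L (A ∘L C)‖ * ‖i‖ := norm_hilbertAdjoint_le _ _
      _ ≤ (‖v‖ * (‖A‖ * ‖C‖)) * ‖i‖ := by
        gcongr
        refine (v.opNorm_comp_le _).trans ?_
        gcongr
        exact A.opNorm_comp_le C
      _ = _ := by ring
  refine memM_of_norm_sub_le_div (K := ‖v‖ * ‖C‖ * ‖i‖ * K) (B := ‖v‖ * ‖C‖ * ‖i‖ * M) hH0 hH hT
    (by positivity) (fun t ht => (hle _).trans ?_) fun s t hs hst htT => ?_
  · gcongr
    exact hM t ht.1.le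
  · rw [← hilbertAdjoint_sub, ← ContinuousLinearMap.comp_sub, ← ContinuousLinearMap.sub_comp,
      mul_assoc _ K]
    refine (hle _).trans ?_
    gcongr
    exact hK s t hs hst htT
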